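/- Let $\mathcal H$ be a complex Hilbert space with scalar product linear in the second entry. For a bounded operator $A$ on $\mathcal H$ put $|A|=(A^*A)^{1/2}$; for real $p\ge 1$ let $\mathcal B_p$ be the set of bounded operators $A$ with $\operatorname{tr}|A|^p<\infty$, and let $\|A\|_p=(\operatorname{tr}|A|^p)^{1/p}$ for $A\in\mathcal B_p$. A spectral decomposition of a bounded operator $A_0$ is a representation $A_0=\sum_{n\in I}\mu_n\,|u_n\rangle\langle u_n|$, convergent in operator norm, where $I=\{0,1,2,\dots\}$ is a finite or infinite initial segment of $\mathbb N$, $(u_n)_{n\in I}$ is an orthonormal family in $\mathcal H$, and the $\mu_n\in\mathbb C$ are nonzero (so that the $\mu_n$ are the nonzero eigenvalues of $A_0$, each repeated according to its multiplicity). Let $1<p<\infty$ and let $A_0,A\in\mathcal B_1$ with $A_0$ normal and $\|A_0\|_1=\|A\|_1=1$. Then $A_0-A\in\mathcal B_1$ and $A_0-A\in\mathcal B_p$, the operator $A_0$ has a spectral decomposition, and for every spectral decomposition $A_0=\sum_{n\in I}\mu_n\,|u_n\rangle\langle u_n|$ we have $\sum_{n\in I}|\mu_n|<\infty$ and $$\|A_0-A\|_1\le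 3\,N^{(p-1)/p}\,\|A_0-A\|_p+2\sum_{n\in I,\ n\ge N}|\mu_n|\qquad\text{for all } N\in\mathbb N=\{0,1,2,\dots\}.$$ -/

import Mathlib

open scoped ENNReal InnerProductSpace

noncomputable section

namespace Schatten

variable {H : Type*} [NormedAddCommGroup H] [InnerProductSpace ℂ H] [CompleteSpace H]

/-- The trace `∑ᵢ ⟨eᵢ, T eᵢ⟩ ∈ [0, ∞]` of a positive operator `T`, computed in the Hilbert basis
`e`. It is used for positive `T` only, where all the terms are nonnegative reals. -/
def traceIn {ι : Type*} (e : HilbertBasis ι ℂ H) (T : H →L[ℂ] H) : ℝ≥0∞ :=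
  ∑' i, ENNReal.ofReal (RCLike.re ⟪e i, T (e i)⟫_ℂ)

theorem traceIn_eq_tsum_tsum {ι κ : Type*} (e : HilbertBasis ι ℂ H) (f : HilbertBasis κ ℂ H)
    {T : H →L[ℂ] H} (hT : 0 ≤ T) :
    traceIn e T = ∑' i, ∑' j, ENNReal.ofReal (‖⟪CFC.sqrt T (e i), f j⟫_ℂ‖ ^ 2) := by
  have hs : ∀ x y : H, ⟪CFC.sqrt T x, y⟫_ℂ = ⟪x, CFC.sqrt T y⟫_ℂ := by
    have := ((ContinuousLinearMap.nonneg_iff_isPositive _).1 (CFC.sqrt_nonneg T)).isSymmetric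
    exact fun x y => this x y
  unfold traceIn
  refine tsum_congr fun i => ?_
  have h1 : T (e i) = CFC.sqrt T (CFC.sqrt T (e i)) := by
    conv_lhs => rw [← CFC.sqrt_mul_sqrt_self T hT]
    rfl
  rw [h1, ← hs, inner_self_eq_norm_sq (𝕜 := ℂ)]
  have h2 := f.hasSum_inner_mul_inner (CFC.sqrt T (e i)) (CFC.sqrt T (e i))
  have h3 : HasSum (fun j => ‖⟪CFC.sqrt T (e i), f j⟫_ℂ‖ ^ 2) (‖CFC.sqrt T (e i)‖ ^ 2) := by
    have h4 := RCLike.hasSum_re ℂ h2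
    rw [inner_self_eq_norm_sq (𝕜 := ℂ)] at h4
    convert h4 using 2 with j
    rw [inner_mul_symm_re_eq_norm, norm_mul, norm_inner_symm (f j), sq]
  rw [← h3.tsum_eq, ENNReal.ofReal_tsum_of_nonneg (fun _ => by positivity) h3.summable]

/-- The trace of a positive operator does not depend on the Hilbert basis. -/
theorem traceIn_eq {ι κ : Type*} (e : HilbertBasis ι ℂ H) (f : HilbertBasis κ ℂ H)
    {T : H →L[ℂ] H} (hT : 0 ≤ T) : traceIn e T = traceIn f T := by
  have hs : ∀ x y : H, ⟪CFC.sqrt T x, y⟫_ℂ = ⟪x, CFC.sqrt T y⟫_ℂ := by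
    have := ((ContinuousLinearMap.nonneg_iff_isPositive _).1 (CFC.sqrt_nonneg T)).isSymmetric
    exact fun x y => this x y
  rw [traceIn_eq_tsum_tsum e f hT, traceIn_eq_tsum_tsum f e hT, ENNReal.tsum_comm]
  refine tsum_congr fun j => tsum_congr fun i => ?_
  rw [hs, norm_inner_symm]

/-- The trace in `[0, ∞]` of a positive operator: its trace in any Hilbert basis. -/
def posTrace (T : H →L[ℂ] H) : ℝ≥0∞ :=
  traceIn (exists_hilbertBasis ℂ H).choose_spec.choose T

theorem posTrace_eq {ι : Type*} (e : HilbertBasis ι ℂ H) {T : H →L[ℂ] H} (hT : 0 ≤ T) :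
    posTrace T = traceIn e T :=
  traceIn_eq _ e hT

/-- Membership in the Schatten ideal: `tr |A|^p < ∞`, where `|A| = (A* A)^{1/2}` and the power is
taken in the continuous functional calculus. For `p = 1` these are the trace-class operators. -/
def MemSchatten (p : ℝ) (A : H →L[ℂ] H) : Prop :=
  posTrace (CFC.abs A ^ p) < ∞

/-- The Schatten norm `‖A‖_p = (tr |A|^p)^{1/p}` of an operator with `tr |A|^p < ∞`. -/
def schattenNorm (p : ℝ) (A : H →L[ℂ] H) : ℝ :=
  (posTrace (CFC.abs A ^ p)).toReal ^ (1 / p)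

/-- `A = ∑_{n ∈ I} μ n |u n⟩⟨u n|` is a spectral decomposition of `A`: the index set `I` is an
initial segment of `ℕ` (finite or all of `ℕ`), the `u n` are orthonormal, the `μ n` are nonzero and
the series converges to `A` in operator norm. Then the `μ n` are the nonzero eigenvalues of `A`,
each repeated according to its multiplicity. -/
structure IsSpectralDecomposition (A : H →L[ℂ] H) (I : Set ℕ) (μ : I → ℂ) (u : I → H) :
    Prop where
  isLowerSet : IsLowerSet I
  orthonormal : Orthonormal ℂ u
  ne_zero : ∀ n, μ n ≠ 0
  hasSum : HasSum (fun n => μ n • InnerProductSpace.rankOne ℂ (u n) (u n)) A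

end Schatten

end

/-! Let `P` project onto the span of the `u n` with `n < N`, put `Q = 1 - P`, `D = A₀ - A`, let `K =
N ^ ((p - 1) / p) * ‖D‖_p`, and let `t` be the sum of `|μ n|` over `n ≥ N`. Then `D = P D + Q D P +
Q A₀ Q - Q A Q`. Hölder's inequality on at most `N` vectors bounds the trace norms of `P D`, `Q D P`
and `P D P` by `K`, and `Q A₀ Q` has trace norm at most `t`. The block `Q A Q` is controlled by
comparing total masses. Pinching gives `‖P A P‖₁ + ‖Q A Q‖₁ ≤ ‖A‖₁ ≤ ‖A₀‖₁ ≤ ‖P A₀ P‖₁ + ‖Q A₀ Q‖₁ ≤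
‖P A P‖₁ + K + t`, whence `‖Q A Q‖₁ ≤ K + t`. Adding up yields `3 K + 2 t`. The trace norm is
handled by duality: it is the supremum of `∑ |⟪f i, X (e i)⟫|` over pairs of Bessel families
(`tsum_enorm_inner_le_eTraceNorm`, `exists_eTraceNorm_le_tsum`). Bessel families are used because,
unlike orthonormal ones, they are stable under contractions. Values in `[0, ∞]` spare summability
arguments. -/

namespace Schatten

/-! ### Bessel families, Jensen's inequality, polar decomposition -/

section

variable {H : Type*} [NormedAddCommGroup H] [InnerProductSpace ℂ H]

/-- A family of vectors satisfying Bessel's inequality. -/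
def IsBessel {ι : Type*} (e : ι → H) : Prop :=
  ∀ x : H, ∑' i, ‖⟪e i, x⟫_ℂ‖ₑ ^ 2 ≤ ‖x‖ₑ ^ 2

theorem enorm_sq_eq_ofReal {E : Type*} [SeminormedAddGroup E] (z : E) :
    ‖z‖ₑ ^ 2 = ENNReal.ofReal (‖z‖ ^ 2) := by
  rw [← ofReal_norm, ENNReal.ofReal_pow (norm_nonneg z)]

theorem enorm_inner_symm (x y : H) : ‖⟪x, y⟫_ℂ‖ₑ = ‖⟪y, x⟫_ℂ‖ₑ := by
  rw [← ofReal_norm, norm_inner_symm, ofReal_norm]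

theorem isBessel_of_orthonormal {ι : Type*} {e : ι → H} (he : Orthonormal ℂ e) : IsBessel e := by
  intro x
  simp only [enorm_sq_eq_ofReal]
  rw [← ENNReal.ofReal_tsum_of_nonneg (fun _ => by positivity) (he.inner_products_summable x)]
  exact ENNReal.ofReal_le_ofReal (he.tsum_inner_products_le x)

/-- Testing Bessel's inequality on `e i` itself gives `‖e i‖ ^ 4 ≤ ‖e i‖ ^ 2`. -/
theorem IsBessel.norm_le_one {ι : Type*} {e : ι → H} (he : IsBessel e) (i : ι) : ‖e i‖ ≤ 1 := by
  have h := (ENNReal.le_tsum i).trans (he (e i))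
  rw [enorm_sq_eq_ofReal, enorm_sq_eq_ofReal, ENNReal.ofReal_le_ofReal_iff (by positivity),
    inner_self_eq_norm_sq_to_K, norm_pow, RCLike.norm_ofReal, abs_norm] at h
  by_contra! h1
  have h2 : 1 < ‖e i‖ ^ 2 := by nlinarith
  nlinarith

theorem tsum_enorm_inner_hilbertBasis_sq {ι : Type*} (b : HilbertBasis ι ℂ H) (x : H) :
    ∑' i, ‖⟪b i, x⟫_ℂ‖ₑ ^ 2 = ‖x‖ₑ ^ 2 := by
  have h2 := b.hasSum_inner_mul_inner x x
  have h3 : HasSum (fun j => ‖⟪b j, x⟫_ℂ‖ ^ 2) (‖x‖ ^ 2) := by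
    have h4 := RCLike.hasSum_re ℂ h2
    rw [inner_self_eq_norm_sq (𝕜 := ℂ)] at h4
    convert h4 using 2 with j
    rw [inner_mul_symm_re_eq_norm, norm_mul, norm_inner_symm x, sq]
  simp only [enorm_sq_eq_ofReal]
  rw [← h3.tsum_eq, ENNReal.ofReal_tsum_of_nonneg (fun _ => by positivity) h3.summable]

variable [CompleteSpace H]

theorem norm_star_apply_le {U : H →L[ℂ] H} (hU : ‖U‖ ≤ 1) (x : H) : ‖star U x‖ ≤ ‖x‖ := by
  have h : ‖star U‖ ≤ 1 := by rwa [norm_star]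
  simpa using (star U).le_of_opNorm_le h x

theorem IsBessel.map {ι : Type*} {e : ι → H} (he : IsBessel e) {U : H →L[ℂ] H} (hU : ‖U‖ ≤ 1) :
    IsBessel fun i => U (e i) := by
  intro x
  have h : ‖star U x‖ₑ ≤ ‖x‖ₑ := by
    rw [← ofReal_norm, ← ofReal_norm]
    exact ENNReal.ofReal_le_ofReal (norm_star_apply_le hU x)
  calc ∑' i, ‖⟪U (e i), x⟫_ℂ‖ₑ ^ 2 = ∑' i, ‖⟪e i, star U x⟫_ℂ‖ₑ ^ 2 := by
        simp [ContinuousLinearMap.star_eq_adjoint, ContinuousLinearMap.adjoint_inner_right]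
    _ ≤ ‖star U x‖ₑ ^ 2 := he _
    _ ≤ ‖x‖ₑ ^ 2 := by gcongr

theorem sqrt_symm (T : H →L[ℂ] H) (x y : H) :
    ⟪CFC.sqrt T x, y⟫_ℂ = ⟪x, CFC.sqrt T y⟫_ℂ :=
  ((ContinuousLinearMap.nonneg_iff_isPositive _).1 (CFC.sqrt_nonneg T)).isSymmetric x y

theorem inner_eq_inner_sqrt {T : H →L[ℂ] H} (hT : 0 ≤ T) (x y : H) :
    ⟪x, T y⟫_ℂ = ⟪CFC.sqrt T x, CFC.sqrt T y⟫_ℂ := by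
  rw [sqrt_symm]
  conv_lhs => rw [← CFC.sqrt_mul_sqrt_self T hT]
  rfl

theorem re_inner_eq_norm_sqrt_sq {T : H →L[ℂ] H} (hT : 0 ≤ T) (x : H) :
    RCLike.re ⟪x, T x⟫_ℂ = ‖CFC.sqrt T x‖ ^ 2 := by
  rw [inner_eq_inner_sqrt hT, inner_self_eq_norm_sq (𝕜 := ℂ)]

/-- Both sides become sums of squares through `√T`. Expand in a Hilbert basis, exchange the sums and
apply Bessel's inequality to each `√T (b k)`. -/
theorem IsBessel.tsum_re_inner_le_posTrace {ι : Type*} {e : ι → H} (he : IsBessel e)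
    {T : H →L[ℂ] H} (hT : 0 ≤ T) :
    ∑' i, ENNReal.ofReal (RCLike.re ⟪e i, T (e i)⟫_ℂ) ≤ posTrace T := by
  obtain ⟨w, b, -⟩ := exists_hilbertBasis ℂ H
  rw [posTrace_eq b hT, traceIn]
  simp only [re_inner_eq_norm_sqrt_sq hT, ← enorm_sq_eq_ofReal]
  calc ∑' i, ‖CFC.sqrt T (e i)‖ₑ ^ 2
      = ∑' i, ∑' k, ‖⟪e i, CFC.sqrt T (b k)⟫_ℂ‖ₑ ^ 2 := by
        refine tsum_congr fun i => ?_
        rw [← tsum_enorm_inner_hilbertBasis_sq b]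
        refine tsum_congr fun k => ?_
        rw [← sqrt_symm, enorm_inner_symm]
    _ = ∑' k, ∑' i, ‖⟪e i, CFC.sqrt T (b k)⟫_ℂ‖ₑ ^ 2 := ENNReal.tsum_comm
    _ ≤ ∑' k, ‖CFC.sqrt T (b k)‖ₑ ^ 2 := ENNReal.tsum_le_tsum fun k => he _

theorem posTrace_mono {S T : H →L[ℂ] H} (hS : 0 ≤ S) (hST : S ≤ T) : posTrace S ≤ posTrace T := by
  obtain ⟨w, b, -⟩ := exists_hilbertBasis ℂ H
  rw [posTrace_eq b hS, posTrace_eq b (hS.trans hST)]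
  refine ENNReal.tsum_le_tsum fun i => ENNReal.ofReal_le_ofReal ?_
  have h := ((ContinuousLinearMap.le_def _ _).1 hST).re_inner_nonneg_right (b i)
  simpa [inner_sub_right] using h

theorem posTrace_smul {c : ℝ} (hc : 0 ≤ c) {T : H →L[ℂ] H} :
    posTrace (c • T) = ENNReal.ofReal c * posTrace T := by
  rw [posTrace, posTrace, traceIn, traceIn, ← ENNReal.tsum_mul_left]
  refine tsum_congr fun i => ?_
  rw [← ENNReal.ofReal_mul hc]
  congr 1
  simp [inner_smul_right_eq_smul]

theorem rpow_eq_cfc {T : H →L[ℂ] H} (hT : 0 ≤ T) (p : ℝ) : T ^ p = cfc (fun t : ℝ => t ^ p) T :=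
  CFC.rpow_eq_cfc_real hT

theorem rpow_le_norm_rpow_smul {T : H →L[ℂ] H} (hT : 0 ≤ T) {p : ℝ} (hp : 1 ≤ p) :
    T ^ p ≤ (‖T‖ ^ (p - 1)) • T := by
  have hsa : IsSelfAdjoint T := .of_nonneg hT
  rw [rpow_eq_cfc hT]
  conv_rhs => rw [← cfc_const_mul_id (‖T‖ ^ (p - 1)) T]
  refine cfc_mono (fun t ht => ?_)
    ((Real.continuous_rpow_const (by linarith)).continuousOn) (by fun_prop)
  have h0 : 0 ≤ t := spectrum_nonneg_of_nonneg hT ht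
  have h1 : t ≤ ‖T‖ := (le_abs_self t).trans <|
    (spectrum.norm_le_norm_mul_of_mem ht).trans <|
      mul_le_of_le_one_right (norm_nonneg T) ContinuousLinearMap.norm_id_le
  rcases h0.eq_or_lt with rfl | h0
  · simp [Real.zero_rpow (by linarith : p ≠ 0)]
  · calc t ^ p = t ^ (p - 1) * t := by rw [← Real.rpow_add_one h0.ne']; simp
      _ ≤ _ := by gcongr

/-- The convex function `t ^ p` lies above its tangent at `s`; this is Bernoulli's inequality for `t
/ s - 1`. -/
theorem rpow_tangent_le {s t p : ℝ} (hs : 0 < s) (ht : 0 ≤ t) (hp : 1 ≤ p) :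
    p * s ^ (p - 1) * t - (p - 1) * s ^ p ≤ t ^ p := by
  have h := one_add_mul_self_le_rpow_one_add (s := t / s - 1)
    (by have : 0 ≤ t / s := by positivity
        linarith) hp
  rw [add_sub_cancel, Real.div_rpow ht hs.le, le_div_iff₀ (by positivity)] at h
  have h1 : s ^ p = s ^ (p - 1) * s := by rw [← Real.rpow_add_one hs.ne']; simp
  calc p * s ^ (p - 1) * t - (p - 1) * s ^ p = (1 + p * (t / s - 1)) * s ^ p := by
        rw [h1]; field_simp; ring
    _ ≤ _ := h

/-- Jensen's inequality for the vector state of a vector in the unit ball. -/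
theorem re_inner_rpow_le {T : H →L[ℂ] H} (hT : 0 ≤ T) {p : ℝ} (hp : 1 ≤ p) {x : H}
    (hx : ‖x‖ ≤ 1) : (RCLike.re ⟪x, T x⟫_ℂ) ^ p ≤ RCLike.re ⟪x, (T ^ p) x⟫_ℂ := by
  have hsa : IsSelfAdjoint T := .of_nonneg hT
  have hTp : 0 ≤ T ^ p := CFC.rpow_nonneg
  set s := RCLike.re ⟪x, T x⟫_ℂ with hsdef
  have hs : 0 ≤ s := by rw [hsdef, re_inner_eq_norm_sqrt_sq hT]; positivity
  rcases hs.eq_or_lt with hs | hs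
  · rw [← hs, Real.zero_rpow (by linarith), re_inner_eq_norm_sqrt_sq hTp]; positivity
  -- The tangent line at `s = ⟪x, T x⟫`, carried to operators by the functional calculus; evaluating
  -- it at `x` gives Jensen.
  have hle : (p * s ^ (p - 1)) • T - ((p - 1) * s ^ p) • (1 : H →L[ℂ] H) ≤ T ^ p := by
    have h1 : (p * s ^ (p - 1)) • T - ((p - 1) * s ^ p) • (1 : H →L[ℂ] H)
        = cfc (fun t : ℝ => p * s ^ (p - 1) * t - (p - 1) * s ^ p) T := by
      rw [cfc_sub .., cfc_const_mul_id .., cfc_const .., Algebra.algebraMap_eq_smul_one]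
    rw [h1, rpow_eq_cfc hT]
    exact cfc_mono (fun t ht => rpow_tangent_le hs (spectrum_nonneg_of_nonneg hT ht) hp)
      (by fun_prop) ((Real.continuous_rpow_const (by linarith)).continuousOn)
  have h := ((ContinuousLinearMap.le_def _ _).1 hle).re_inner_nonneg_right x
  have h2 : RCLike.re ⟪x, ((p * s ^ (p - 1)) • T - ((p - 1) * s ^ p) • (1 : H →L[ℂ] H)) x⟫_ℂ
      = p * s ^ (p - 1) * s - (p - 1) * s ^ p * ‖x‖ ^ 2 := by
    rw [hsdef, ← inner_self_eq_norm_sq (𝕜 := ℂ) x]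
    simp [inner_smul_right_eq_smul]
  rw [sub_apply, inner_sub_right, map_sub, h2] at h
  have h1 : s ^ p = s ^ (p - 1) * s := by rw [← Real.rpow_add_one hs.ne']; simp
  have h3 : (p - 1) * s ^ p * ‖x‖ ^ 2 ≤ (p - 1) * s ^ p * 1 := by
    have : 0 ≤ p - 1 := by linarith
    gcongr
    exact pow_le_one₀ (norm_nonneg _) hx
  nlinarith

/-- Polar decomposition. -/
theorem exists_polar (X : H →L[ℂ] H) :
    ∃ U : H →L[ℂ] H, ‖U‖ ≤ 1 ∧ X = U * CFC.abs X ∧ CFC.abs X = star U * X := by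
  set T := CFC.abs X with hTdef
  have hT : 0 ≤ T := CFC.abs_nonneg X
  have hin : ∀ x y : H, ⟪T x, T y⟫_ℂ = ⟪X x, X y⟫_ℂ := fun x y => by
    rw [show ⟪T x, T y⟫_ℂ = ⟪x, T (T y)⟫_ℂ from
      ((ContinuousLinearMap.nonneg_iff_isPositive _).1 hT).isSymmetric x (T y),
      ← ContinuousLinearMap.adjoint_inner_right X, ← ContinuousLinearMap.star_eq_adjoint]
    exact congrArg (fun S : H →L[ℂ] H => ⟪x, S y⟫_ℂ) (CFC.abs_mul_abs X)
  have hnorm : ∀ x, ‖X x‖ = ‖T x‖ := fun x => by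
    rw [norm_eq_sqrt_re_inner (𝕜 := ℂ), norm_eq_sqrt_re_inner (𝕜 := ℂ) (T x), hin]
  -- As `‖X x‖ = ‖T x‖`, the map `T x ↦ X x` is well defined and extends to the closed range of `T`;
  -- it is then set to zero on the orthogonal complement.
  let K := (LinearMap.range T.toLinearMap).topologicalClosure
  have hmem : ∀ x, T x ∈ K := fun x =>
    Submodule.le_topologicalClosure _ (LinearMap.mem_range_self T.toLinearMap x)
  let e : H →ₗ[ℂ] K := T.toLinearMap.codRestrict K hmem
  have hdense : DenseRange e := by
    intro z
    rw [Topology.IsInducing.subtypeVal.closure_eq_preimage_closure_image, Set.mem_preimage,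
      ← Set.range_comp]
    exact z.2
  have : CompleteSpace K := (Submodule.isClosed_topologicalClosure _).completeSpace_coe
  let V : K →L[ℂ] H := X.toLinearMap.extendOfNorm e
  have hbd : ∀ x, ‖X.toLinearMap x‖ ≤ 1 * ‖e x‖ := fun x => by
    rw [one_mul]; exact (hnorm x).le
  have hV : ∀ x, V (e x) = X x := fun x => LinearMap.extendOfNorm_eq hdense ⟨1, hbd⟩ x
  have hVn : ‖V‖ ≤ 1 := LinearMap.opNorm_extendOfNorm_le hdense zero_le_one hbd
  have hproj : ∀ x, K.orthogonalProjectionOnto (T x) = e x := fun x =>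
    Submodule.orthogonalProjectionOnto_mem_subspace_eq_self (e x)
  refine ⟨V ∘L K.orthogonalProjectionOnto, ?_, ?_, ?_⟩
  · calc ‖V ∘L K.orthogonalProjectionOnto‖ ≤ ‖V‖ * ‖K.orthogonalProjectionOnto‖ :=
          ContinuousLinearMap.opNorm_comp_le _ _
      _ ≤ 1 * 1 := by gcongr; exact K.orthogonalProjectionOnto_norm_le
      _ = 1 := one_mul 1
  · ext x
    simp [hproj, hV]
  · ext x
    refine ext_inner_left ℂ fun y => ?_
    rw [mul_apply_eq_comp, ContinuousLinearMap.star_eq_adjoint,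
      ContinuousLinearMap.adjoint_inner_right]
    have hz : ∀ z : K, ⟪V z, X x⟫_ℂ = ⟪(z : H), T x⟫_ℂ := by
      intro z
      refine isClosed_property hdense (p := fun z : K => ⟪V z, X x⟫_ℂ = ⟪(z : H), T x⟫_ℂ)
        (isClosed_eq (by fun_prop) (by fun_prop)) (fun w => ?_) z
      rw [hV, ← hin]; rfl
    rw [ContinuousLinearMap.comp_apply, hz]
    exact (Submodule.inner_orthogonalProjectionOnto_eq_of_mem_right ⟨T x, hmem x⟩ y).symm

end

/-! ### Duality for the trace norm, pinching, Hölder -/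

section

variable {H : Type*} [NormedAddCommGroup H] [InnerProductSpace ℂ H]

/-- The orthogonal projection onto the span of a finite orthonormal family. -/
noncomputable def spanProj {ι : Type*} [Fintype ι] (u : ι → H) : H →L[ℂ] H :=
  ∑ j, InnerProductSpace.rankOne ℂ (u j) (u j)

theorem spanProj_apply {ι : Type*} [Fintype ι] (u : ι → H) (x : H) :
    spanProj u x = ∑ j, ⟪u j, x⟫_ℂ • u j := by
  simp [spanProj]

variable [CompleteSpace H]

/-- Write `⟪y, X x⟫ = ⟪√|X| U* y, √|X| x⟫`; then Cauchy–Schwarz, Jensen for each factor, and `2ab ≤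
a² + b²`. -/
theorem norm_inner_rpow_le {X U : H →L[ℂ] H} (hU : ‖U‖ ≤ 1) (hX : X = U * CFC.abs X) {p : ℝ}
    (hp : 1 ≤ p) {x y : H} (hx : ‖x‖ ≤ 1) (hy : ‖y‖ ≤ 1) :
    ‖⟪y, X x⟫_ℂ‖ ^ p ≤ (RCLike.re ⟪star U y, (CFC.abs X ^ p) (star U y)⟫_ℂ +
      RCLike.re ⟪x, (CFC.abs X ^ p) x⟫_ℂ) / 2 := by
  have hT : 0 ≤ CFC.abs X := CFC.abs_nonneg X
  set R := CFC.sqrt (CFC.abs X)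
  have hUy : ‖star U y‖ ≤ 1 := (norm_star_apply_le hU y).trans hy
  have h1 : ⟪y, X x⟫_ℂ = ⟪R (star U y), R x⟫_ℂ := by
    rw [← inner_eq_inner_sqrt hT, ContinuousLinearMap.star_eq_adjoint,
      ContinuousLinearMap.adjoint_inner_left]
    conv_lhs => rw [hX]
    rfl
  have h2 : ∀ z : H, ‖z‖ ≤ 1 → (‖R z‖ ^ p) ^ 2 ≤ RCLike.re ⟪z, (CFC.abs X ^ p) z⟫_ℂ := by
    intro z hz
    have h := re_inner_rpow_le hT hp hz
    rw [re_inner_eq_norm_sqrt_sq hT] at h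
    convert h using 1
    rw [← Real.rpow_natCast, ← Real.rpow_natCast, ← Real.rpow_mul (norm_nonneg _),
      ← Real.rpow_mul (norm_nonneg _), mul_comm]
  have h3 : ‖⟪y, X x⟫_ℂ‖ ^ p ≤ ‖R (star U y)‖ ^ p * ‖R x‖ ^ p := by
    rw [h1, ← Real.mul_rpow (norm_nonneg _) (norm_nonneg _)]
    exact Real.rpow_le_rpow (norm_nonneg _) (norm_inner_le_norm _ _) (by linarith)
  nlinarith [h2 _ hUy, h2 _ hx, sq_nonneg (‖R (star U y)‖ ^ p - ‖R x‖ ^ p)]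

theorem tsum_enorm_inner_rpow_le {ι : Type*} {e f : ι → H} (he : IsBessel e) (hf : IsBessel f)
    (X : H →L[ℂ] H) {p : ℝ} (hp : 1 ≤ p) :
    ∑' i, ‖⟪f i, X (e i)⟫_ℂ‖ₑ ^ p ≤ posTrace (CFC.abs X ^ p) := by
  obtain ⟨U, hU, hX, -⟩ := exists_polar X
  have hTp : 0 ≤ CFC.abs X ^ p := CFC.rpow_nonneg
  have hnn : ∀ z : H, 0 ≤ RCLike.re ⟪z, (CFC.abs X ^ p) z⟫_ℂ := fun z => by
    rw [re_inner_eq_norm_sqrt_sq hTp]; positivity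
  have hf' : IsBessel fun i => star U (f i) := hf.map (by rwa [norm_star])
  calc ∑' i, ‖⟪f i, X (e i)⟫_ℂ‖ₑ ^ p
      ≤ ∑' i, (ENNReal.ofReal (RCLike.re ⟪star U (f i), (CFC.abs X ^ p) (star U (f i))⟫_ℂ) +
          ENNReal.ofReal (RCLike.re ⟪e i, (CFC.abs X ^ p) (e i)⟫_ℂ)) * 2⁻¹ := by
        refine ENNReal.tsum_le_tsum fun i => ?_
        rw [← ofReal_norm, ENNReal.ofReal_rpow_of_nonneg (norm_nonneg _) (by linarith),
          ← ENNReal.ofReal_add (hnn _) (hnn _), ← div_eq_mul_inv,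
          ← ENNReal.ofReal_ofNat 2, ← ENNReal.ofReal_div_of_pos two_pos]
        exact ENNReal.ofReal_le_ofReal
          (norm_inner_rpow_le hU hX hp (he.norm_le_one i) (hf.norm_le_one i))
    _ ≤ (posTrace (CFC.abs X ^ p) + posTrace (CFC.abs X ^ p)) * 2⁻¹ := by
        rw [ENNReal.tsum_mul_right, ENNReal.tsum_add]
        gcongr
        · exact hf'.tsum_re_inner_le_posTrace hTp
        · exact he.tsum_re_inner_le_posTrace hTp
    _ = posTrace (CFC.abs X ^ p) := by
        rw [← div_eq_mul_inv, ENNReal.add_div, ENNReal.add_halves]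

/-- The trace norm `tr |X|`, with values in `[0, ∞]`. -/
noncomputable def eTraceNorm (X : H →L[ℂ] H) : ℝ≥0∞ :=
  posTrace (CFC.abs X)

theorem posTrace_abs_rpow_one (X : H →L[ℂ] H) : posTrace (CFC.abs X ^ (1 : ℝ)) = eTraceNorm X := by
  rw [CFC.rpow_one _ (CFC.abs_nonneg X), eTraceNorm]

theorem tsum_enorm_inner_le_eTraceNorm {ι : Type*} {e f : ι → H} (he : IsBessel e)
    (hf : IsBessel f) (X : H →L[ℂ] H) :
    ∑' i, ‖⟪f i, X (e i)⟫_ℂ‖ₑ ≤ eTraceNorm X := by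
  simpa [posTrace_abs_rpow_one] using tsum_enorm_inner_rpow_le he hf X le_rfl

theorem ofReal_re_le_enorm (z : ℂ) : ENNReal.ofReal (RCLike.re z) ≤ ‖z‖ₑ := by
  rw [← ofReal_norm]
  exact ENNReal.ofReal_le_ofReal (RCLike.re_le_norm z)

/-- By polar decomposition `⟪b i, |X| b i⟫ = ⟪U (b i), X (b i)⟫`, so a Hilbert basis and its image
under `U` attain the supremum. -/
theorem exists_eTraceNorm_le_tsum (X : H →L[ℂ] H) :
    ∃ (w : Set H) (e f : w → H), IsBessel e ∧ IsBessel f ∧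
      eTraceNorm X ≤ ∑' i, ‖⟪f i, X (e i)⟫_ℂ‖ₑ := by
  obtain ⟨U, hU, -, hX⟩ := exists_polar X
  obtain ⟨w, b, -⟩ := exists_hilbertBasis ℂ H
  have hb := isBessel_of_orthonormal b.orthonormal
  refine ⟨w, b, fun i => U (b i), hb, hb.map hU, ?_⟩
  rw [eTraceNorm, posTrace_eq b (CFC.abs_nonneg X), traceIn]
  refine ENNReal.tsum_le_tsum fun i => (ofReal_re_le_enorm _).trans_eq ?_
  rw [hX, mul_apply_eq_comp, ContinuousLinearMap.star_eq_adjoint,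
    ContinuousLinearMap.adjoint_inner_right]

theorem eTraceNorm_add_le (X Y : H →L[ℂ] H) :
    eTraceNorm (X + Y) ≤ eTraceNorm X + eTraceNorm Y := by
  obtain ⟨w, e, f, he, hf, h⟩ := exists_eTraceNorm_le_tsum (X + Y)
  refine h.trans ?_
  calc ∑' i, ‖⟪f i, (X + Y) (e i)⟫_ℂ‖ₑ
      ≤ ∑' i, (‖⟪f i, X (e i)⟫_ℂ‖ₑ + ‖⟪f i, Y (e i)⟫_ℂ‖ₑ) := by
        refine ENNReal.tsum_le_tsum fun i => ?_
        rw [add_apply, inner_add_right]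
        exact enorm_add_le _ _
    _ ≤ _ := by
        rw [ENNReal.tsum_add]
        exact add_le_add (tsum_enorm_inner_le_eTraceNorm he hf X)
          (tsum_enorm_inner_le_eTraceNorm he hf Y)

theorem eTraceNorm_neg (X : H →L[ℂ] H) : eTraceNorm (-X) = eTraceNorm X := by
  rw [eTraceNorm, CFC.abs_neg, eTraceNorm]

theorem eTraceNorm_sub_le (X Y : H →L[ℂ] H) :
    eTraceNorm (X - Y) ≤ eTraceNorm X + eTraceNorm Y := by
  simpa [sub_eq_add_neg, eTraceNorm_neg] using eTraceNorm_add_le X (-Y)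

theorem eTraceNorm_star_le (X : H →L[ℂ] H) : eTraceNorm (star X) ≤ eTraceNorm X := by
  obtain ⟨w, e, f, he, hf, h⟩ := exists_eTraceNorm_le_tsum (star X)
  refine h.trans (le_trans (le_of_eq ?_) (tsum_enorm_inner_le_eTraceNorm hf he X))
  refine tsum_congr fun i => ?_
  rw [ContinuousLinearMap.star_eq_adjoint, ContinuousLinearMap.adjoint_inner_right,
    enorm_inner_symm]

theorem eTraceNorm_star (X : H →L[ℂ] H) : eTraceNorm (star X) = eTraceNorm X :=
  le_antisymm (eTraceNorm_star_le X) (by simpa using eTraceNorm_star_le (star X))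

theorem inner_star_projection_apply {P : H →L[ℂ] H} (hP : IsStarProjection P) (x y : H) :
    ⟪P x, y⟫_ℂ = ⟪x, P y⟫_ℂ := by
  rw [← ContinuousLinearMap.adjoint_inner_right, ← ContinuousLinearMap.star_eq_adjoint,
    hP.isSelfAdjoint.star_eq]

theorem enorm_sq_add_enorm_sq {P : H →L[ℂ] H} (hP : IsStarProjection P) (x : H) :
    ‖P x‖ₑ ^ 2 + ‖(1 - P) x‖ₑ ^ 2 = ‖x‖ₑ ^ 2 := by
  have h0 : ⟪P x, (1 - P) x⟫_ℂ = 0 := by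
    rw [inner_star_projection_apply hP, ← mul_apply_eq_comp, mul_sub, mul_one,
      hP.isIdempotentElem.eq, sub_self]
    simp
  have h := norm_add_sq_eq_norm_sq_add_norm_sq_of_inner_eq_zero (𝕜 := ℂ) _ _ h0
  have h1 : P x + (1 - P) x = x := by simp
  rw [h1] at h
  simp only [enorm_sq_eq_ofReal]
  rw [← ENNReal.ofReal_add (by positivity) (by positivity)]
  congr 1
  rw [sq, sq, sq, h]

/-- Pythagoras: the two halves test `P x` and `(1 - P) x`, whose squared norms add up to `‖x‖ ^ 2`.
-/
theorem isBessel_sumElim {P : H →L[ℂ] H} (hP : IsStarProjection P) {ι κ : Type*} {e : ι → H}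
    {f : κ → H} (he : IsBessel e) (hf : IsBessel f) :
    IsBessel (Sum.elim (fun i => P (e i)) (fun j => (1 - P) (f j))) := by
  intro x
  rw [ENNReal.summable.tsum_sum ENNReal.summable]
  simp only [Sum.elim_inl, Sum.elim_inr, inner_star_projection_apply hP,
    inner_star_projection_apply hP.one_sub]
  rw [← enorm_sq_add_enorm_sq hP x]
  exact add_le_add (he _) (hf _)

/-- Pinching inequality for the trace norm. -/
theorem eTraceNorm_pinching_le {P : H →L[ℂ] H} (hP : IsStarProjection P) (X : H →L[ℂ] H) :
    eTraceNorm (P * X * P) + eTraceNorm ((1 - P) * X * (1 - P)) ≤ eTraceNorm X := by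
  obtain ⟨v, e, f, he, hf, h⟩ := exists_eTraceNorm_le_tsum (P * X * P)
  obtain ⟨w, e', f', he', hf', h'⟩ := exists_eTraceNorm_le_tsum ((1 - P) * X * (1 - P))
  -- Near-optimal choices are not needed: the attaining families of the two blocks, projected and
  -- joined, form one admissible pair for `X`.
  refine (add_le_add h h').trans (le_trans (le_of_eq ?_)
    (tsum_enorm_inner_le_eTraceNorm (isBessel_sumElim hP he he') (isBessel_sumElim hP hf hf') X))
  rw [ENNReal.summable.tsum_sum ENNReal.summable]
  simp only [Sum.elim_inl, Sum.elim_inr, inner_star_projection_apply hP,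
    inner_star_projection_apply hP.one_sub, mul_apply_eq_comp]

theorem enorm_mul_enorm_le {α β : ℂ} :
    ‖α‖ₑ * ‖β‖ₑ ≤ (‖α‖ₑ ^ 2 + ‖β‖ₑ ^ 2) * 2⁻¹ := by
  rw [enorm_sq_eq_ofReal, enorm_sq_eq_ofReal, ← ofReal_norm, ← ofReal_norm,
    ← ENNReal.ofReal_mul (norm_nonneg _), ← ENNReal.ofReal_add (by positivity) (by positivity),
    ← div_eq_mul_inv, ← ENNReal.ofReal_ofNat 2, ← ENNReal.ofReal_div_of_pos two_pos]
  refine ENNReal.ofReal_le_ofReal ?_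
  nlinarith [sq_nonneg (‖α‖ - ‖β‖)]

/-- In the dual formula, AM–GM splits `|⟪f i, a n⟫ ⟪a n, e i⟫|` into squares, and Bessel sums each
over `i` to at most `‖a n‖ ^ 2`. -/
theorem eTraceNorm_le_tsum_of_hasSum {ι : Type*} {c : ι → ℂ} {a : ι → H} {X : H →L[ℂ] H}
    (hX : HasSum (fun n => c n • InnerProductSpace.rankOne ℂ (a n) (a n)) X) :
    eTraceNorm X ≤ ∑' n, ‖c n‖ₑ * ‖a n‖ₑ ^ 2 := by
  obtain ⟨w, e, f, he, hf, h⟩ := exists_eTraceNorm_le_tsum X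
  refine h.trans ?_
  have hterm : ∀ i, ‖⟪f i, X (e i)⟫_ℂ‖ₑ ≤
      ∑' n, ‖c n‖ₑ * ((‖⟪f i, a n⟫_ℂ‖ₑ ^ 2 + ‖⟪e i, a n⟫_ℂ‖ₑ ^ 2) * 2⁻¹) := by
    intro i
    have h1 : HasSum (fun n => c n * (⟪f i, a n⟫_ℂ * ⟪a n, e i⟫_ℂ)) ⟪f i, X (e i)⟫_ℂ := by
      have := (hX.mapL (ContinuousLinearMap.apply ℂ H (e i))).mapL (innerSL ℂ (f i))
      simpa [inner_smul_right, mul_comm] using this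
    rw [← h1.tsum_eq]
    refine enorm_tsum_le_tsum_enorm.trans (ENNReal.tsum_le_tsum fun n => ?_)
    rw [enorm_mul, enorm_mul, enorm_inner_symm (e i)]
    exact mul_le_mul_right enorm_mul_enorm_le _
  refine (ENNReal.tsum_le_tsum hterm).trans ?_
  rw [ENNReal.tsum_comm]
  refine ENNReal.tsum_le_tsum fun n => ?_
  rw [ENNReal.tsum_mul_left, ENNReal.tsum_mul_right, ENNReal.tsum_add]
  gcongr
  calc _ ≤ (‖a n‖ₑ ^ 2 + ‖a n‖ₑ ^ 2) * 2⁻¹ := by gcongr; exacts [hf _, he _]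
    _ = ‖a n‖ₑ ^ 2 := by rw [← div_eq_mul_inv, ENNReal.add_div, ENNReal.add_halves]

theorem isStarProjection_spanProj {ι : Type*} [Fintype ι] {u : ι → H} (hu : Orthonormal ℂ u) :
    IsStarProjection (spanProj u) := by
  classical
  refine ⟨?_, ?_⟩
  · ext x
    rw [mul_apply_eq_comp, spanProj_apply, spanProj_apply]
    refine Finset.sum_congr rfl fun j _ => ?_
    rw [hu.inner_right_fintype]
  · rw [spanProj]
    refine isSelfAdjoint_sum _ fun j _ => ?_
    rw [IsSelfAdjoint, ContinuousLinearMap.star_eq_adjoint, InnerProductSpace.adjoint_rankOne]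

/-- Cyclicity of the trace: with `|P X| = U* P X`, the trace equals `∑ j, ⟪u j, X U* (u j)⟫`, so `g
j = U* (u j)`. The infinite sum becomes one over the span, ready for Hölder. -/
theorem exists_eTraceNorm_spanProj_mul_le {ι : Type*} [Fintype ι] {u : ι → H}
    (hu : Orthonormal ℂ u) (X : H →L[ℂ] H) :
    ∃ g : ι → H, IsBessel g ∧ eTraceNorm (spanProj u * X) ≤ ∑ j, ‖⟪u j, X (g j)⟫_ℂ‖ₑ := by
  obtain ⟨U, hU, -, hX⟩ := exists_polar (spanProj u * X)
  obtain ⟨w, b, -⟩ := exists_hilbertBasis ℂ H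
  refine ⟨fun j => star U (u j), (isBessel_of_orthonormal hu).map (by rwa [norm_star]), ?_⟩
  have hT := CFC.abs_nonneg (spanProj u * X)
  have hs : HasSum (fun k => ⟪b k, CFC.abs (spanProj u * X) (b k)⟫_ℂ)
      (∑ j, ⟪u j, X (star U (u j))⟫_ℂ) := by
    have h1 := hasSum_sum (s := Finset.univ) fun j (_ : j ∈ Finset.univ) =>
      b.hasSum_inner_mul_inner (star X (u j)) (star U (u j))
    convert! h1 using 1
    · ext k
      rw [hX]
      simp only [mul_apply_eq_comp, spanProj_apply, map_sum, map_smul, inner_sum,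
        inner_smul_right, ContinuousLinearMap.star_eq_adjoint,
        ContinuousLinearMap.adjoint_inner_left, ContinuousLinearMap.adjoint_inner_right]
    · simp only [ContinuousLinearMap.star_eq_adjoint, ContinuousLinearMap.adjoint_inner_left]
  have hre := RCLike.hasSum_re ℂ hs
  rw [eTraceNorm, posTrace_eq b hT, traceIn, ← ENNReal.ofReal_tsum_of_nonneg
    (fun k => by rw [re_inner_eq_norm_sqrt_sq hT]; positivity) hre.summable, hre.tsum_eq]
  exact (ofReal_re_le_enorm _).trans (enorm_sum_le _ _)

/-- Hölder's inequality for a finite Bessel family. -/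
theorem sum_enorm_inner_le {ι : Type*} [Fintype ι] {e f : ι → H} (he : IsBessel e)
    (hf : IsBessel f) (X : H →L[ℂ] H) {p : ℝ} (hp : 1 < p) :
    ∑ j, ‖⟪f j, X (e j)⟫_ℂ‖ₑ ≤
      (Fintype.card ι : ℝ≥0∞) ^ ((p - 1) / p) * posTrace (CFC.abs X ^ p) ^ (1 / p) := by
  have hpq : p.HolderConjugate (p / (p - 1)) := Real.HolderConjugate.conjExponent hp
  have h := ENNReal.inner_le_Lp_mul_Lq Finset.univ (fun j => ‖⟪f j, X (e j)⟫_ℂ‖ₑ) (fun _ => 1) hpq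
  simp only [mul_one, ENNReal.one_rpow, Finset.sum_const, Finset.card_univ, nsmul_eq_mul] at h
  rw [mul_comm, one_div_div] at h
  refine h.trans ?_
  gcongr
  have h1 := tsum_enorm_inner_rpow_le he hf X hp.le
  rwa [tsum_fintype] at h1

end

/-! ### Compactness and the spectral theorem -/

section

variable {H : Type*} [NormedAddCommGroup H] [InnerProductSpace ℂ H]

theorem isCompactOperator_rankOne (x y : H) :
    IsCompactOperator (InnerProductSpace.rankOne ℂ x y : H →L[ℂ] H) := by
  rw [InnerProductSpace.rankOne_def']
  exact (isCompactOperator_of_locallyCompactSpace_dom (innerSL ℂ y)).clm_comp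
    (ContinuousLinearMap.toSpanSingleton ℂ x)

theorem orthonormal_insert {s : Set H} (hs : Orthonormal ℂ (Subtype.val : s → H)) {e : H}
    (he : ‖e‖ = 1) (hes : ∀ v ∈ s, ⟪v, e⟫_ℂ = 0) :
    Orthonormal ℂ (Subtype.val : ↥(insert e s) → H) := by
  refine ⟨?_, ?_⟩
  · rintro ⟨a, rfl | ha⟩
    exacts [he, hs.1 ⟨a, ha⟩]
  · rintro ⟨a, rfl | ha⟩ ⟨b, rfl | hb⟩ hab
    · exact absurd rfl hab
    · exact inner_eq_zero_symm.1 (hes b hb)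
    · exact hes a ha
    · exact hs.2 (i := ⟨a, ha⟩) (j := ⟨b, hb⟩) fun h => hab (Subtype.ext (by simpa using h))

theorem exists_isLowerSet_equiv (J : Type*) [Countable J] :
    ∃ I : Set ℕ, IsLowerSet I ∧ Nonempty (I ≃ J) := by
  rcases finite_or_infinite J with hJ | hJ
  · exact ⟨Set.Iio (Nat.card J), isLowerSet_Iio _,
      ⟨(Fin.equivSubtype (n := Nat.card J)).symm.trans (Finite.equivFin J).symm⟩⟩
  · obtain ⟨hd⟩ := nonempty_denumerable J
    exact ⟨Set.univ, isLowerSet_univ, ⟨(Equiv.Set.univ ℕ).trans (Denumerable.eqv J).symm⟩⟩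

variable [CompleteSpace H]

theorem posTrace_abs_rpow_le (X : H →L[ℂ] H) {p : ℝ} (hp : 1 ≤ p) :
    posTrace (CFC.abs X ^ p) ≤ ENNReal.ofReal (‖CFC.abs X‖ ^ (p - 1)) * eTraceNorm X := by
  rw [eTraceNorm, ← posTrace_smul (by positivity)]
  exact posTrace_mono CFC.rpow_nonneg (rpow_le_norm_rpow_smul (CFC.abs_nonneg X) hp)

theorem posTrace_abs_rpow_lt_top {X : H →L[ℂ] H} (hX : eTraceNorm X < ∞) {p : ℝ} (hp : 1 ≤ p) :
    posTrace (CFC.abs X ^ p) < ∞ :=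
  (posTrace_abs_rpow_le X hp).trans_lt (ENNReal.mul_lt_top ENNReal.ofReal_lt_top hX)

theorem tsum_enorm_apply_sq_lt_top {X : H →L[ℂ] H} (hX : eTraceNorm X < ∞) {ι : Type*}
    (b : HilbertBasis ι ℂ H) : ∑' k, ‖X (b k)‖ₑ ^ 2 < ∞ := by
  have h := posTrace_abs_rpow_lt_top hX one_le_two
  rw [posTrace_eq b CFC.rpow_nonneg, traceIn] at h
  convert! h using 3 with k
  have h2 : CFC.abs X ^ (2 : ℝ) = star X * X := by
    rw [← CFC.abs_sq, ← CFC.rpow_natCast _ 2 (CFC.abs_nonneg X)]; norm_num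
  rw [h2, enorm_sq_eq_ofReal, mul_apply_eq_comp, ContinuousLinearMap.star_eq_adjoint,
    ContinuousLinearMap.adjoint_inner_right, inner_self_eq_norm_sq (𝕜 := ℂ)]

/-- `X` is Hilbert–Schmidt, and `X* x` has coefficients `⟪X (b k), x⟫`. Keeping finitely many leaves
an error whose squared norm is at most a tail of `∑ ‖X (b k)‖ ^ 2`, so `X*` is a norm limit of
finite-rank operators. -/
theorem isCompactOperator_star {X : H →L[ℂ] H} (hX : eTraceNorm X < ∞) :
    IsCompactOperator (star X : H →L[ℂ] H) := by
  classical
  obtain ⟨w, b, -⟩ := exists_hilbertBasis ℂ H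
  set r : Finset w → ℝ≥0∞ := fun F => ∑' k : {k // k ∉ F}, ‖X (b k)‖ₑ ^ 2 with hr
  have hfin := tsum_enorm_apply_sq_lt_top hX b
  have hr0 : Filter.Tendsto r Filter.atTop (nhds 0) :=
    ENNReal.tendsto_tsum_compl_atTop_zero hfin.ne
  have hrfin : ∀ F, r F ≠ ∞ := fun F =>
    ((ENNReal.tsum_comp_le_tsum_of_injective Subtype.coe_injective _).trans_lt hfin).ne
  let S : Finset w → H →L[ℂ] H := fun F =>
    ∑ k ∈ F, InnerProductSpace.rankOne ℂ (b k) (X (b k))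
  have hcoef : ∀ F k x, ⟪b k, (star X - S F) x⟫_ℂ = if k ∈ F then 0 else ⟪X (b k), x⟫_ℂ := by
    intro F k x
    have h1 : ⟪b k, S F x⟫_ℂ = if k ∈ F then ⟪X (b k), x⟫_ℂ else 0 := by
      simp [S, orthonormal_iff_ite.1 b.orthonormal]
    rw [sub_apply, inner_sub_right, h1, ContinuousLinearMap.star_eq_adjoint,
      ContinuousLinearMap.adjoint_inner_right]
    split_ifs <;> simp
  have hle : ∀ F x, ‖(star X - S F) x‖ₑ ^ 2 ≤ r F * ‖x‖ₑ ^ 2 := by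
    intro F x
    rw [← tsum_enorm_inner_hilbertBasis_sq b, hr, ← ENNReal.tsum_mul_right]
    simp only [hcoef]
    rw [← tsum_subtype_eq_of_support_subset (s := {k | k ∉ F})]
    · refine ENNReal.tsum_le_tsum fun k => ?_
      rw [if_neg k.2, ← mul_pow]
      gcongr
      rw [← ofReal_norm, ← ofReal_norm, ← ofReal_norm, ← ENNReal.ofReal_mul (norm_nonneg _)]
      exact ENNReal.ofReal_le_ofReal (norm_inner_le_norm _ _)
    · intro k hk hkF
      exact hk (by simp [hkF])
  have hnorm : ∀ F, ‖star X - S F‖ ≤ Real.sqrt (r F).toReal := by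
    intro F
    refine ContinuousLinearMap.opNorm_le_bound _ (Real.sqrt_nonneg _) fun x => ?_
    refine (sq_le_sq₀ (norm_nonneg _) (by positivity)).1 ?_
    have h := ENNReal.toReal_mono (ENNReal.mul_ne_top (hrfin F) (by simp)) (hle F x)
    rw [mul_pow, Real.sq_sqrt ENNReal.toReal_nonneg]
    simpa using h
  have hlim : Filter.Tendsto S Filter.atTop (nhds (star X)) := by
    rw [tendsto_iff_norm_sub_tendsto_zero]
    refine squeeze_zero (fun _ => norm_nonneg _)
      (fun F => (norm_sub_rev _ _).trans_le (hnorm F)) ?_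
    have h1 := (ENNReal.tendsto_toReal ENNReal.zero_ne_top).comp hr0
    simpa using! (Real.continuous_sqrt.tendsto _).comp h1
  refine isCompactOperator_of_tendsto hlim (Filter.Eventually.of_forall fun F => ?_)
  exact (compactOperator (RingHom.id ℂ) H H).sum_mem fun k _ => isCompactOperator_rankOne _ _

/-- `A - c` is normal, so it and its adjoint have the same kernel. -/
theorem star_apply_of_apply_eq_smul {A : H →L[ℂ] H} (hA : IsStarNormal A) {c : ℂ} {v : H}
    (hv : A v = c • v) : star A v = (starRingEnd ℂ c) • v := by
  have hn : IsStarNormal (A - c • (1 : H →L[ℂ] H)) := by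
    refine ⟨?_⟩
    have h := hA.star_comm_self
    simp only [star_sub, star_smul, star_one, commute_iff_eq, sub_mul, mul_sub, smul_mul_assoc,
      mul_smul_comm, one_mul, mul_one] at h ⊢
    rw [h, smul_sub, smul_sub, smul_comm]
    abel
  have h := ContinuousLinearMap.isStarNormal_iff_norm_eq_adjoint.1 hn v
  rw [← ContinuousLinearMap.star_eq_adjoint] at h
  have h0 : (A - c • (1 : H →L[ℂ] H)) v = 0 := by simp [hv]
  rw [h0, norm_zero, eq_comm, norm_eq_zero] at h
  rw [← sub_eq_zero]
  simpa using h

/-- The compression `S` of `A* A` to `V` is compact and self-adjoint. If `S = 0`, then `A` vanishes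
on `V`. Otherwise a nonzero eigenvalue of `S` has a finite-dimensional eigenspace inside `V`;
normality makes it invariant under `A`, which has an eigenvector there. -/
theorem exists_eigenvector_mem {A : H →L[ℂ] H} (hA : IsStarNormal A)
    (hc : IsCompactOperator (star A * A : H →L[ℂ] H)) {V : Submodule ℂ H} [V.HasOrthogonalProjection]
    (hVA : ∀ x ∈ V, A x ∈ V) (hVA' : ∀ x ∈ V, star A x ∈ V) (hV : V ≠ ⊥) :
    ∃ x ∈ V, x ≠ 0 ∧ ∃ c : ℂ, A x = c • x := by
  set P := V.starProjection with hPdef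
  set S : H →L[ℂ] H := P * (star A * A) * P with hSdef
  have hP : ∀ x ∈ V, P x = x := fun x hx => Submodule.starProjection_eq_self_iff.2 hx
  have hPm : ∀ x, P x ∈ V := fun x => Submodule.starProjection_apply_mem _ _
  have hSV : ∀ x ∈ V, S x = star A (A x) := fun x hx => by
    simp only [hSdef, mul_apply_eq_comp, hP x hx]
    exact hP _ (hVA' _ (hVA _ hx))
  have hSc : IsCompactOperator S := (hc.comp_clm P).clm_comp P
  have hPsa : IsSelfAdjoint P := isSelfAdjoint_starProjection V
  have hSsa : IsSelfAdjoint S := by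
    have := (IsSelfAdjoint.star_mul_self A).conjugate P
    rwa [hPsa.star_eq] at this
  by_cases hS0 : S = 0
  · obtain ⟨x, hx, hx0⟩ := V.exists_mem_ne_zero_of_ne_bot hV
    refine ⟨x, hx, hx0, 0, ?_⟩
    have h1 : star A (A x) = 0 := by rw [← hSV x hx, hS0]; simp
    have h2 : ⟪A x, A x⟫_ℂ = 0 := by
      rw [← ContinuousLinearMap.adjoint_inner_right, ← ContinuousLinearMap.star_eq_adjoint, h1,
        inner_zero_right]
    rw [zero_smul, inner_self_eq_zero.1 h2]
  · have h := mt (ContinuousLinearMap.eq_zero_of_forall_hasEigenvalue_eq_zero hSc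
      hSsa.isSymmetric).1 hS0
    push Not at h
    obtain ⟨μ, hμ, hμ0⟩ := h
    have := ContinuousLinearMap.finite_dimensional_eigenspace hSc μ hμ0
    set E := Module.End.eigenspace S.toLinearMap μ with hE
    have hEV : ∀ x ∈ E, x ∈ V := fun x hx => by
      have h1 : S x = μ • x := Module.End.mem_eigenspace_iff.1 hx
      have h2 : x = μ⁻¹ • S x := by rw [h1, inv_smul_smul₀ hμ0]
      rw [h2]
      exact V.smul_mem _ (hPm _)
    have hEA : ∀ x ∈ E, A.toLinearMap x ∈ E := fun x hx => by
      have h1 : S x = μ • x := Module.End.mem_eigenspace_iff.1 hx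
      rw [hSV x (hEV x hx)] at h1
      refine Module.End.mem_eigenspace_iff.2 ?_
      change S (A x) = μ • A x
      rw [hSV _ (hVA _ (hEV x hx)), ← map_smul, ← h1]
      exact congrArg (fun B : H →L[ℂ] H => B (A x)) hA.star_comm_self.eq
    have : Nontrivial E := Submodule.nontrivial_iff_ne_bot.2 hμ
    obtain ⟨c, hcE⟩ := Module.End.exists_eigenvalue (A.toLinearMap.restrict hEA)
    obtain ⟨x, hx⟩ := hcE.exists_hasEigenvector
    refine ⟨x, hEV x x.2, fun h0 => hx.2 (Subtype.ext h0), c, ?_⟩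
    simpa using congrArg Subtype.val hx.apply_eq_smul

/-- The spectral theorem for compact normal operators. -/
theorem exists_hilbertBasis_eigenvectors {A : H →L[ℂ] H} (hA : IsStarNormal A)
    (hc : IsCompactOperator (star A * A : H →L[ℂ] H)) :
    ∃ (w : Set H) (b : HilbertBasis w ℂ H) (μ : w → ℂ), ∀ i, A (b i) = μ i • b i := by
  -- A maximal orthonormal set of eigenvectors: its complement reduces `A`, so a nonzero complement
  -- would supply one more.
  obtain ⟨s, hs⟩ := zorn_subset {s : Set H | Orthonormal ℂ (Subtype.val : s → H) ∧
      ∀ v ∈ s, ∃ c : ℂ, A v = c • v} fun C hC hchain => by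
    refine ⟨⋃₀ C, ⟨orthonormal_sUnion_of_directed hchain.directedOn fun a ha => (hC ha).1, ?_⟩,
      fun t ht => Set.subset_sUnion_of_mem ht⟩
    rintro v ⟨t, ht, hv⟩
    exact (hC ht).2 v hv
  obtain ⟨hon, heig⟩ := hs.prop
  have hbot : (Submodule.span ℂ s)ᗮ = ⊥ := by
    by_contra hV
    have hmem : ∀ x, x ∈ (Submodule.span ℂ s)ᗮ ↔ ∀ v ∈ s, ⟪v, x⟫_ℂ = 0 := fun x =>
      ⟨fun hx v hv => hx v (Submodule.subset_span hv), fun h =>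
        Submodule.mem_orthogonal _ _ |>.2 fun u hu => by
          induction hu using Submodule.span_induction with
          | mem v hv => exact h v hv
          | zero => simp
          | add u v _ _ hu hv => rw [inner_add_left, hu, hv, add_zero]
          | smul c v _ hv => rw [inner_smul_left, hv, mul_zero]⟩
    obtain ⟨x, hx, hx0, c, hxc⟩ := exists_eigenvector_mem hA hc (V := (Submodule.span ℂ s)ᗮ)
      (fun x hx => (hmem _).2 fun v hv => by
        obtain ⟨c, hvc⟩ := heig v hv
        rw [← ContinuousLinearMap.adjoint_inner_left, ← ContinuousLinearMap.star_eq_adjoint,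
          star_apply_of_apply_eq_smul hA hvc, inner_smul_left, (hmem x).1 hx v hv, mul_zero])
      (fun x hx => (hmem _).2 fun v hv => by
        obtain ⟨c, hvc⟩ := heig v hv
        rw [ContinuousLinearMap.star_eq_adjoint, ContinuousLinearMap.adjoint_inner_right, hvc,
          inner_smul_left, (hmem x).1 hx v hv, mul_zero]) hV
    set e := ((‖x‖⁻¹ : ℝ) : ℂ) • x with he
    have he1 : ‖e‖ = 1 := by
      rw [he, norm_smul, Complex.norm_real, norm_inv, norm_norm, inv_mul_cancel₀ (by simpa)]
    have heV : ∀ v ∈ s, ⟪v, e⟫_ℂ = 0 := fun v hv => by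
      rw [he, inner_smul_right, (hmem x).1 hx v hv, mul_zero]
    have hins := hs.eq_of_ge (y := insert e s) ⟨orthonormal_insert hon he1 heV, by
      rintro v (rfl | hv)
      · exact ⟨c, by rw [he, map_smul, hxc, smul_comm]⟩
      · exact heig v hv⟩ (Set.subset_insert e s)
    have hes : e ∈ s := hins ▸ Set.mem_insert e s
    have h0 := inner_self_eq_zero.1 (heV e hes)
    rw [h0, norm_zero] at he1
    exact zero_ne_one he1
  choose μ hμ using fun i : s => heig i i.2
  refine ⟨s, HilbertBasis.mkOfOrthogonalEqBot hon (by simpa using hbot), μ, fun i => ?_⟩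
  simpa using hμ i

theorem summable_norm_of_eigenvectors {A : H →L[ℂ] H} (hA : eTraceNorm A < ∞) {ι : Type*}
    {u : ι → H} (hu : Orthonormal ℂ u) {μ : ι → ℂ} (hAu : ∀ i, A (u i) = μ i • u i) :
    Summable fun i => ‖μ i‖ := by
  have h := tsum_enorm_inner_le_eTraceNorm (isBessel_of_orthonormal hu)
    (isBessel_of_orthonormal hu) A
  have h1 : ∀ i, ⟪u i, A (u i)⟫_ℂ = μ i := fun i => by
    rw [hAu, inner_smul_right, inner_self_eq_norm_sq_to_K, hu.1 i]; simp
  simp only [h1] at h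
  have h2 := ENNReal.summable_toReal (h.trans_lt hA).ne
  simpa using h2

theorem exists_isSpectralDecomposition {A : H →L[ℂ] H} (hA : IsStarNormal A)
    (htr : eTraceNorm A < ∞) :
    ∃ (I : Set ℕ) (μ : I → ℂ) (u : I → H), IsSpectralDecomposition A I μ u := by
  obtain ⟨w, b, μ, hμ⟩ := exists_hilbertBasis_eigenvectors hA
    ((isCompactOperator_star htr).comp_clm A)
  have hsum := summable_norm_of_eigenvectors htr b.orthonormal hμ
  set F : w → H →L[ℂ] H := fun i => μ i • InnerProductSpace.rankOne ℂ (b i) (b i) with hF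
  have hFs : Summable F := by
    refine Summable.of_norm ?_
    convert hsum using 2 with i
    rw [hF, norm_smul, InnerProductSpace.norm_rankOne, b.orthonormal.1 i]
    simp
  have hFA : HasSum F A := by
    convert hFs.hasSum
    ext x
    have h1 := (b.hasSum_repr x).mapL A
    have h2 := hFs.hasSum.mapL (ContinuousLinearMap.apply ℂ H x)
    refine h1.unique ?_
    convert! h2 using 2 with i
    rw [map_smul, hμ, b.repr_apply_apply, smul_comm]
    rfl
  -- Dropping the kernel leaves a countable family, since the eigenvalues are absolutely summable.
  let J := Function.support μ
  have : Countable J := by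
    have : J = Function.support fun i => ‖μ i‖ := by ext; simp [J]
    rw [this]
    exact hsum.countable_support.to_subtype
  obtain ⟨I, hI, ⟨φ⟩⟩ := exists_isLowerSet_equiv J
  refine ⟨I, fun n => μ (φ n), fun n => b (φ n), hI, ?_, fun n => (φ n).2, ?_⟩
  · exact b.orthonormal.comp _ (Subtype.val_injective.comp φ.injective)
  · have hJ : HasSum (F ∘ Subtype.val : J → H →L[ℂ] H) A := by
      refine (hasSum_subtype_iff_of_support_subset fun i hi => ?_).2 hFA
      exact fun h => hi (by simp [hF, h])
    exact (φ.hasSum_iff (f := F ∘ Subtype.val) (a := A)).2 hJ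

end

/-! ### The estimate -/

section

variable {H : Type*} [NormedAddCommGroup H] [InnerProductSpace ℂ H]

theorem IsSpectralDecomposition.apply_eq_smul {A : H →L[ℂ] H} {I : Set ℕ} {μ : I → ℂ} {u : I → H}
    (h : IsSpectralDecomposition A I μ u) (n : I) : A (u n) = μ n • u n := by
  have h1 := h.hasSum.mapL (ContinuousLinearMap.apply ℂ H (u n))
  refine h1.unique ?_
  convert hasSum_single n fun m hm => ?_
  · simp [h.orthonormal.1 n]
  · simp [h.orthonormal.2 hm]

variable [CompleteSpace H]

theorem IsSpectralDecomposition.hasSum_mul_mul {A : H →L[ℂ] H} {I : Set ℕ} {μ : I → ℂ}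
    {u : I → H} (h : IsSpectralDecomposition A I μ u) (B C : H →L[ℂ] H) :
    HasSum (fun n => μ n • InnerProductSpace.rankOne ℂ (B (u n)) (star C (u n))) (B * A * C) := by
  convert! (h.hasSum.mul_left B).mul_right C using 2 with n
  rw [mul_smul_comm, smul_mul_assoc]
  congr 1
  ext x
  simp [ContinuousLinearMap.star_eq_adjoint, ContinuousLinearMap.adjoint_inner_left]

theorem eTraceNorm_sub_le_of_isSpectralDecomposition {A₀ A : H →L[ℂ] H} {I : Set ℕ} {μ : I → ℂ}
    {u : I → H} (h : IsSpectralDecomposition A₀ I μ u) (hA : eTraceNorm A < ∞)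
    (hle : eTraceNorm A ≤ eTraceNorm A₀) {p : ℝ} (hp : 1 < p) (N : ℕ) :
    eTraceNorm (A₀ - A) ≤
      3 * ((N : ℝ≥0∞) ^ ((p - 1) / p) * posTrace (CFC.abs (A₀ - A) ^ p) ^ (1 / p)) +
        2 * ∑' n : {n : I // N ≤ (n : ℕ)}, ‖μ n‖ₑ := by
  classical
  set D := A₀ - A with hD
  set K := (N : ℝ≥0∞) ^ ((p - 1) / p) * posTrace (CFC.abs D ^ p) ^ (1 / p) with hK
  set t := ∑' n : {n : I // N ≤ (n : ℕ)}, ‖μ n‖ₑ with ht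
  let J := {n : I // (n : ℕ) < N}
  let ψ : J → Fin N := fun n => ⟨n.1, n.2⟩
  have hψ : Function.Injective ψ := fun a b hab =>
    Subtype.ext (Subtype.ext (congrArg Fin.val hab))
  have : Fintype J := Fintype.ofInjective ψ hψ
  -- Only an inequality, since `I` may have fewer than `N` elements.
  have hcard : Fintype.card J ≤ N := by simpa using Fintype.card_le_of_injective ψ hψ
  let v : J → H := fun n => u n
  have hv : Orthonormal ℂ v := h.orthonormal.comp _ Subtype.val_injective
  have hvB := isBessel_of_orthonormal hv
  set P := spanProj v with hPdef
  set Q := 1 - P with hQdef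
  have hP : IsStarProjection P := isStarProjection_spanProj hv
  have hQ : IsStarProjection Q := hP.one_sub
  have hPQ : P + Q = 1 := by rw [hQdef]; abel
  have hPu : ∀ n : I, (n : ℕ) < N → P (u n) = u n := fun n hn => by
    rw [hPdef, spanProj_apply, Finset.sum_eq_single (⟨n, hn⟩ : J)]
    · simp [v, h.orthonormal.1 n]
    · intro m _ hm
      rw [h.orthonormal.2 fun h' => hm (Subtype.ext h'), zero_smul]
    · simp
  have hPu' : ∀ n : I, N ≤ (n : ℕ) → P (u n) = 0 := fun n hn => by
    rw [hPdef, spanProj_apply]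
    refine Finset.sum_eq_zero fun m _ => ?_
    rw [h.orthonormal.2 fun h' => ?_, zero_smul]
    have := m.2
    rw [h'] at this
    omega
  have hQu : ∀ n : I, (n : ℕ) < N → Q (u n) = 0 := fun n hn => by simp [hQdef, hPu n hn]
  have hQu' : ∀ n : I, N ≤ (n : ℕ) → Q (u n) = u n := fun n hn => by simp [hQdef, hPu' n hn]
  have hQnorm : ‖Q‖ ≤ 1 := hQ.norm_le
  have hPnorm : ‖P‖ ≤ 1 := hP.norm_le
  have hHolder : ∀ {e f : J → H}, IsBessel e → IsBessel f →
      ∑ j, ‖⟪f j, D (e j)⟫_ℂ‖ₑ ≤ K := fun he hf => by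
    refine (sum_enorm_inner_le he hf D hp).trans ?_
    rw [hK]
    have : 0 ≤ (p - 1) / p := by apply div_nonneg <;> linarith
    gcongr
  have hPD : eTraceNorm (P * D) ≤ K := by
    obtain ⟨g, hg, hle⟩ := exists_eTraceNorm_spanProj_mul_le hv D
    exact hle.trans (hHolder hg hvB)
  have hPDP : eTraceNorm (P * D * P) ≤ K := by
    obtain ⟨g, hg, hle⟩ := exists_eTraceNorm_spanProj_mul_le hv (D * P)
    rw [mul_assoc]
    exact hle.trans (hHolder (hg.map hPnorm) hvB)
  -- Passing to the adjoint `P D* Q` puts the finite-rank projection on the left.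
  have hQDP : eTraceNorm (Q * D * P) ≤ K := by
    obtain ⟨g, hg, hle⟩ := exists_eTraceNorm_spanProj_mul_le hv (star D * Q)
    rw [← eTraceNorm_star, star_mul, star_mul, hP.isSelfAdjoint.star_eq, hQ.isSelfAdjoint.star_eq]
    refine (hle.trans (le_of_eq ?_)).trans (hHolder hvB (hg.map hQnorm))
    refine Finset.sum_congr rfl fun j _ => ?_
    rw [mul_apply_eq_comp, ContinuousLinearMap.star_eq_adjoint,
      ContinuousLinearMap.adjoint_inner_right, enorm_inner_symm]
  have hQAQ₀ : eTraceNorm (Q * A₀ * Q) ≤ t := by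
    have h1 := h.hasSum_mul_mul Q Q
    rw [hQ.isSelfAdjoint.star_eq] at h1
    refine (eTraceNorm_le_tsum_of_hasSum h1).trans (le_of_eq ?_)
    rw [ht, ← tsum_subtype_eq_of_support_subset (s := {n : I | N ≤ (n : ℕ)})]
    · refine tsum_congr fun n => ?_
      rw [hQu' n.1 n.2, ← ofReal_norm (u n), h.orthonormal.1]
      simp
    · intro n hn
      by_contra hnN
      exact hn (by simp [hQu n (not_le.1 hnN)])
  have hPAQ₀ : P * A₀ * Q = 0 := by
    refine (h.hasSum_mul_mul P Q).unique ?_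
    convert! hasSum_zero with n
    rw [hQ.isSelfAdjoint.star_eq]
    rcases lt_or_ge (n : ℕ) N with hn | hn
    · simp [hQu n hn]
    · simp [hPu' n hn]
  have hQAP₀ : Q * A₀ * P = 0 := by
    refine (h.hasSum_mul_mul Q P).unique ?_
    convert! hasSum_zero with n
    rw [hP.isSelfAdjoint.star_eq]
    rcases lt_or_ge (n : ℕ) N with hn | hn
    · simp [hQu n hn]
    · simp [hPu' n hn]
  have hsplit : ∀ X : H →L[ℂ] H, X = P * X * P + P * X * Q + Q * X * P + Q * X * Q := fun X => by
    calc X = (P + Q) * X * (P + Q) := by rw [hPQ, one_mul, mul_one]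
      _ = _ := by noncomm_ring
  have hA₀split : A₀ = P * A₀ * P + Q * A₀ * Q := by
    conv_lhs => rw [hsplit A₀, hPAQ₀, hQAP₀, add_zero, add_zero]
  -- `P D P` and `P D Q` stay together as `P D`, which costs a single `K`.
  have hDsplit : D = P * D + Q * D * P + (Q * A₀ * Q - Q * A * Q) := by
    calc D = (P + Q) * D * (P + Q) := by rw [hPQ, one_mul, mul_one]
      _ = P * D * (P + Q) + Q * D * P + Q * D * Q := by noncomm_ring
      _ = _ := by rw [hPQ, mul_one, hD]; noncomm_ring
  have hPAP₀ : eTraceNorm (P * A₀ * P) ≤ eTraceNorm (P * A * P) + K := by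
    have : P * A₀ * P = P * A * P + P * D * P := by rw [hD]; noncomm_ring
    rw [this]
    exact (eTraceNorm_add_le _ _).trans (by gcongr)
  have hpinch : eTraceNorm (P * A * P) + eTraceNorm (Q * A * Q) ≤ eTraceNorm A :=
    eTraceNorm_pinching_le hP A
  have hQAQ : eTraceNorm (Q * A * Q) ≤ K + t := by
    -- Finiteness permits cancelling `‖P A P‖₁` in `[0, ∞]`.
    have hfin : eTraceNorm (P * A * P) ≠ ∞ := ((le_self_add.trans hpinch).trans_lt hA).ne
    refine (ENNReal.add_le_add_iff_left hfin).1 ?_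
    calc _ ≤ eTraceNorm A₀ := hpinch.trans hle
      _ ≤ eTraceNorm (P * A₀ * P) + eTraceNorm (Q * A₀ * Q) := by
          conv_lhs => rw [hA₀split]
          exact eTraceNorm_add_le _ _
      _ ≤ eTraceNorm (P * A * P) + K + t := add_le_add hPAP₀ hQAQ₀
      _ = _ := add_assoc _ _ _
  calc eTraceNorm D
      ≤ eTraceNorm (P * D) + eTraceNorm (Q * D * P) +
          (eTraceNorm (Q * A₀ * Q) + eTraceNorm (Q * A * Q)) := by
        conv_lhs => rw [hDsplit]
        exact (eTraceNorm_add_le _ _).trans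
          (add_le_add (eTraceNorm_add_le _ _) (eTraceNorm_sub_le _ _))
    _ ≤ K + K + (t + (K + t)) := by gcongr
    _ = 3 * K + 2 * t := by ring

theorem schattenNorm_one (X : H →L[ℂ] H) : schattenNorm 1 X = (eTraceNorm X).toReal := by
  rw [schattenNorm, posTrace_abs_rpow_one, one_div_one, Real.rpow_one]

theorem memSchatten_one_iff {X : H →L[ℂ] H} : MemSchatten 1 X ↔ eTraceNorm X < ∞ := by
  rw [MemSchatten, posTrace_abs_rpow_one]

end

end Schatten

theorem theorem1 {H : Type*} [NormedAddCommGroup H] [InnerProductSpace ℂ H] [CompleteSpace H]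
    (p : ℝ) (hp : 1 < p) (A₀ A : H →L[ℂ] H)
    (hA₀ : Schatten.MemSchatten 1 A₀) (hA : Schatten.MemSchatten 1 A)
    (hnormal : IsStarNormal A₀)
    (hnormA₀ : Schatten.schattenNorm 1 A₀ = 1) (hnormA : Schatten.schattenNorm 1 A = 1) :
    Schatten.MemSchatten 1 (A₀ - A) ∧ Schatten.MemSchatten p (A₀ - A) ∧
    (∃ (I : Set ℕ) (μ : I → ℂ) (u : I → H), Schatten.IsSpectralDecomposition A₀ I μ u) ∧
    ∀ (I : Set ℕ) (μ : I → ℂ) (u : I → H), Schatten.IsSpectralDecomposition A₀ I μ u →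
      Summable (fun n => ‖μ n‖) ∧
      ∀ N : ℕ, Schatten.schattenNorm 1 (A₀ - A) ≤
        3 * (N : ℝ) ^ ((p - 1) / p) * Schatten.schattenNorm p (A₀ - A) +
          2 * ∑' n : {n : I // N ≤ (n : ℕ)}, ‖μ n‖ := by
  rw [Schatten.memSchatten_one_iff] at hA₀ hA
  rw [Schatten.schattenNorm_one] at hnormA₀ hnormA
  have hD : Schatten.eTraceNorm (A₀ - A) < ∞ :=
    (Schatten.eTraceNorm_sub_le A₀ A).trans_lt (ENNReal.add_lt_top.2 ⟨hA₀, hA⟩)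
  have hDp := Schatten.posTrace_abs_rpow_lt_top hD hp.le
  refine ⟨Schatten.memSchatten_one_iff.2 hD, hDp,
    Schatten.exists_isSpectralDecomposition hnormal hA₀, fun I μ u h => ?_⟩
  have hsum := Schatten.summable_norm_of_eigenvectors hA₀ h.orthonormal h.apply_eq_smul
  refine ⟨hsum, fun N => ?_⟩
  -- The normalisation enters only through this comparison of trace norms.
  have hle : Schatten.eTraceNorm A ≤ Schatten.eTraceNorm A₀ :=
    ((ENNReal.toReal_eq_toReal_iff' hA.ne hA₀.ne).1 (hnormA.trans hnormA₀.symm)).le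
  have hmain := Schatten.eTraceNorm_sub_le_of_isSpectralDecomposition h hA hle hp N
  have htail : ∑' n : {n : I // N ≤ (n : ℕ)}, ‖μ n‖ₑ =
      ENNReal.ofReal (∑' n : {n : I // N ≤ (n : ℕ)}, ‖μ n‖) := by
    rw [ENNReal.ofReal_tsum_of_nonneg (fun _ => norm_nonneg _)
      (hsum.comp_injective Subtype.val_injective)]
    simp only [ofReal_norm]
  have hp0 : 0 ≤ 1 / p := by positivity
  have hp1 : 0 ≤ (p - 1) / p := div_nonneg (by linarith) (by linarith)
  have hK : (N : ℝ≥0∞) ^ ((p - 1) / p) *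
      Schatten.posTrace (CFC.abs (A₀ - A) ^ p) ^ (1 / p) ≠ ∞ :=
    ENNReal.mul_ne_top (ENNReal.rpow_ne_top_of_nonneg hp1 (ENNReal.natCast_ne_top N))
      (ENNReal.rpow_ne_top_of_nonneg hp0 hDp.ne)
  rw [htail] at hmain
  have hreal := ENNReal.toReal_mono (ENNReal.add_ne_top.2
    ⟨ENNReal.mul_ne_top (by simp) hK, ENNReal.mul_ne_top (by simp) ENNReal.ofReal_ne_top⟩) hmain
  rw [ENNReal.toReal_add (ENNReal.mul_ne_top (by simp) hK)
    (ENNReal.mul_ne_top (by simp) ENNReal.ofReal_ne_top), ENNReal.toReal_mul, ENNReal.toReal_mul,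
    ENNReal.toReal_mul, ENNReal.toReal_ofReal (tsum_nonneg fun _ => norm_nonneg _),
    ← ENNReal.toReal_rpow, ← ENNReal.toReal_rpow, ENNReal.toReal_natCast] at hreal
  rw [Schatten.schattenNorm_one, mul_assoc, Schatten.schattenNorm]
  simpa using hreal
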